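/- Call a topological space $X$ *coanalytic* if it is homeomorphic to a subspace $X'$ of a Polish space $P$ such that $P\setminus X'$ is analytic (in particular, $X$ is separable and metrizable). A family $\mathcal{A}$ of subsets of $X$ is *adequate* if (i) $A\in\mathcal{A}$ and $B\subseteq A$ imply $B\in\mathcal{A}$, and (ii) a set $B\subseteq X$ belongs to $\mathcal{A}$ whenever all finite subsets of $B$ belong to $\mathcal{A}$. An adequate family $\mathcal{A}$ of closed subsets of $X$ is *cofinal* if every infinite closed discrete subset $B$ of $X$ has an infinite subset $A\subseteq B$ with $A\in\mathcal{A}$. For $Z\subseteq X$ put $\mathcal{A}|_Z=\{A\cap Z : A\in\mathcal{A}\}$, regarded, through indicator functions, as a subspace of the product $\{0,1\}^X$. A compact Hausdorff space $K$ is an *Eberlein compact* if the Banach space $C(K)$ of real continuous functions on $K$ with the supremum norm is weakly compactly generated, that is, $C(K)$ has a weakly compact subset whose linear span is norm-dense. **Theorem.** Let $X$ be a coanalytic space, let $\mathcal{A}$ be a cofinal adequate family of closed subsets of $X$, and let $Z$ be a subset of $X$. Then $\mathcal{A}|_Z$ is an Eberlein compact if and only if $Z$ is contained in some $\sigma$-compact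 subset of $X$. -/

import Mathlib

open Set Topology

/-- A coanalytic space: a topological space homeomorphic to a subspace of some Polish space whose
complement is analytic. Such a space is automatically separable and metrizable. -/
def IsCoanalyticSpace.{u} (X : Type u) [TopologicalSpace X] : Prop :=
  ∃ (P : Type u) (_ : TopologicalSpace P) (f : X → P),
    PolishSpace P ∧ IsEmbedding f ∧ MeasureTheory.AnalyticSet (range f)ᶜ

/-- An adequate family of subsets of `X`: it is closed under taking subsets, and it contains
every set all of whose finite subsets it contains. -/
structure IsAdequateFamily {X : Type*} (𝒜 : Set (Set X)) : Prop where
  hereditary : ∀ A ∈ 𝒜, ∀ B, B ⊆ A → B ∈ 𝒜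
  finite_character : ∀ B : Set X, (∀ F, F ⊆ B → F.Finite → F ∈ 𝒜) → B ∈ 𝒜

/-- A cofinal adequate family of closed subsets of the topological space `X`: every infinite
closed discrete subset of `X` has an infinite subset that belongs to the family. -/
structure IsCofinalAdequateFamily {X : Type*} [TopologicalSpace X] (𝒜 : Set (Set X)) : Prop
    extends IsAdequateFamily 𝒜 where
  closed : ∀ A ∈ 𝒜, IsClosed A
  cofinal : ∀ B : Set X, B.Infinite → IsClosed B → IsDiscrete B →
    ∃ A, A ⊆ B ∧ A.Infinite ∧ A ∈ 𝒜

/-- The restriction `𝒜|_Z = {A ∩ Z : A ∈ 𝒜}` of a family of sets to a set `Z`. -/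
def restrictFamily {X : Type*} (𝒜 : Set (Set X)) (Z : Set X) : Set (Set X) :=
  {B | ∃ A ∈ 𝒜, B = A ∩ Z}

/-- A family of subsets of `X` viewed as a subset of the product `{0,1}^X`, through indicator
functions. Its coercion to a type carries the subspace topology of the product topology. -/
def familyInCube {X : Type*} (𝓕 : Set (Set X)) : Set (X → Bool) :=
  {x | {t | x t = true} ∈ 𝓕}

/-- A weakly compactly generated (WCG) normed space: some weakly compact subset has a norm-dense
linear span. -/
def IsWeaklyCompactlyGenerated (E : Type*) [NormedAddCommGroup E] [NormedSpace ℝ E] : Prop :=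
  ∃ W : Set E, IsCompact (toWeakSpace ℝ E '' W) ∧ Dense (Submodule.span ℝ W : Set E)

/-- An Eberlein compact: a compact Hausdorff space `K` such that the Banach space `C(K)` of
continuous real functions with the supremum norm is weakly compactly generated. -/
def IsEberleinCompact (K : Type*) [TopologicalSpace K] : Prop :=
  ∃ _ : CompactSpace K, T2Space K ∧ IsWeaklyCompactlyGenerated C(K, ℝ)

open Filter MeasureTheory

open scoped NNReal CompactlySupported

/-! ### Relative compactness in metrizable spaces -/

section Topology

variable {X : Type*} [TopologicalSpace X]

/-! Let `K` be the compact space `𝒜|_Z`. If a weakly compact `W` generates `C(K)`, combinations of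
`m` elements of `W` with coefficients in `[-n, n]` form pointwise compact sets `T m n` with
norm-dense union. Hence `Z` is the union of the sets `S m n` of points whose coordinate function is
within `1 / 4` of `T m n`. By `finite_of_coordinateFunction_near_compact`, no infinite member of `𝒜`
lies in `S m n`; by cofinality `S m n` has no infinite closed discrete subset, so its closure is
compact, `X` being metrizable.

Conversely, all subsets of a member of `𝒜` are closed, so it is closed and discrete and meets
compact sets in finite sets. If compact sets `C n` cover `Z`, finite products of coordinate
functions, scaled down according to the pieces they involve, tend to zero pointwise, hence weakly
(Riesz representation and dominated convergence). With `0` they form a weakly compact set, and their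
span is dense by Stone–Weierstrass. -/

theorem isDiscrete_of_forall_subset_isClosed {A : Set X} (h : ∀ B ⊆ A, IsClosed B) :
    IsDiscrete A := by
  refine ⟨discreteTopology_iff_forall_isClosed.2 fun s => ?_⟩
  have := (h (Subtype.val '' s) (by rintro _ ⟨x, -, rfl⟩; exact x.2)).preimage
    (continuous_subtype_val (p := (· ∈ A)))
  rwa [preimage_image_eq _ Subtype.val_injective] at this

/-- In a metrizable space, a set without infinite subsets that are closed and discrete is
relatively compact. -/
theorem isCompact_closure_of_forall_finite [TopologicalSpace.MetrizableSpace X] {S : Set X}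
    (h : ∀ B ⊆ S, IsClosed B → IsDiscrete B → B.Finite) : IsCompact (closure S) := by
  let _ := TopologicalSpace.metrizableSpaceMetric X
  -- A sequence without cluster points would have a closed discrete range, finite by `h`; but a
  -- sequence in a finite set clusters.
  have key : ∀ x : ℕ → X, (∀ n, x n ∈ S) → ∃ a, MapClusterPt a atTop x := by
    intro x hx
    by_contra! hcl
    have hlf : LocallyFinite fun n => ({x n} : Set X) := by
      intro a
      have := hcl a
      rw [mapClusterPt_iff_frequently] at this
      push Not at this
      obtain ⟨s, hs, hfin⟩ := this
      refine ⟨s, hs, ?_⟩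
      rw [← Nat.cofinite_eq_atTop, eventually_cofinite] at hfin
      refine hfin.subset ?_
      rintro n ⟨y, hy, hys⟩
      rw [mem_singleton_iff.1 hy] at hys
      simpa using hys
    have hsub : ∀ B ⊆ range x, IsClosed B := by
      intro B hB
      have : B = ⋃ n : x ⁻¹' B, {x n} := by
        ext y
        simp only [mem_iUnion, mem_singleton_iff]
        constructor
        · intro hy
          obtain ⟨n, rfl⟩ := hB hy
          exact ⟨⟨n, hy⟩, rfl⟩
        · rintro ⟨n, rfl⟩
          exact n.2
      rw [this]
      exact (hlf.comp_injective (g := ((↑) : x ⁻¹' B → ℕ)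
        ) Subtype.val_injective).isClosed_iUnion fun _ => isClosed_singleton
    have hfin : (range x).Finite := h _ (range_subset_iff.2 hx) (hsub _ subset_rfl)
      (isDiscrete_of_forall_subset_isClosed hsub)
    obtain ⟨a, -, ha⟩ := hfin.isCompact.exists_mapClusterPt (f := atTop) (u := x)
      (by simp)
    exact hcl a ha
  refine IsSeqCompact.isCompact fun y hy => ?_
  have hpos : ∀ n : ℕ, (0 : ℝ) < 1 / ((n : ℝ) + 1) := fun n => by positivity
  choose x hx hxy using fun n => Metric.mem_closure_iff.1 (hy n) _ (hpos n)
  obtain ⟨a, ha⟩ := key x hx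
  obtain ⟨φ, hφ, hlim⟩ := ha.tendsto_subseq
  refine ⟨a, ?_, φ, hφ, ?_⟩
  · exact mem_closure_of_tendsto hlim (Eventually.of_forall fun n => hx _)
  · refine hlim.congr_dist ?_
    refine squeeze_zero (fun _ => dist_nonneg) (fun n => ?_)
      (tendsto_one_div_add_atTop_nhds_zero_nat.comp hφ.tendsto_atTop)
    rw [dist_comm]
    exact (hxy (φ n)).le

end Topology

/-! ### Pointwise versus weak convergence in `C(K)` -/

section WeakConvergence

variable {K : Type*} [TopologicalSpace K]

/-- The total variation of a functional on `C(K, ℝ)`, evaluated at a function `f`: the supremum of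
`φ g` over all `g` dominated by `f`. -/
noncomputable def functionalVariation (φ : C(K, ℝ) →L[ℝ] ℝ) (f : C(K, ℝ)) : ℝ :=
  sSup (φ '' {g | ∀ x, |g x| ≤ f x})

namespace functionalVariation

variable {φ : C(K, ℝ) →L[ℝ] ℝ}

theorem le_of_forall {f : C(K, ℝ)} (hf : ∀ x, 0 ≤ f x) {c : ℝ}
    (h : ∀ g : C(K, ℝ), (∀ x, |g x| ≤ f x) → φ g ≤ c) : functionalVariation φ f ≤ c := by
  refine csSup_le ⟨_, 0, fun x => by simpa using hf x, rfl⟩ ?_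
  rintro _ ⟨g, hg, rfl⟩
  exact h g hg

variable [CompactSpace K]

theorem bddAbove (φ : C(K, ℝ) →L[ℝ] ℝ) (f : C(K, ℝ)) : BddAbove (φ '' {g | ∀ x, |g x| ≤ f x}) := by
  refine ⟨‖φ‖ * ‖f‖, ?_⟩
  rintro _ ⟨g, hg, rfl⟩
  refine (le_abs_self _).trans ((φ.le_opNorm g).trans ?_)
  gcongr
  rw [ContinuousMap.norm_le _ (norm_nonneg _)]
  exact fun x => (hg x).trans ((le_abs_self _).trans (f.norm_coe_le_norm x))

theorem le_of_dominated {f g : C(K, ℝ)} (h : ∀ x, |g x| ≤ f x) :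
    φ g ≤ functionalVariation φ f :=
  le_csSup (bddAbove φ f) ⟨g, h, rfl⟩

theorem nonneg {f : C(K, ℝ)} (hf : ∀ x, 0 ≤ f x) : 0 ≤ functionalVariation φ f := by
  simpa using le_of_dominated (φ := φ) (f := f) (g := 0) (fun x => by simpa using hf x)

theorem abs_le {f : C(K, ℝ)} (hf : ∀ x, 0 ≤ f x) : |φ f| ≤ functionalVariation φ f := by
  refine abs_le'.2 ⟨le_of_dominated fun x => (abs_of_nonneg (hf x)).le, ?_⟩
  rw [← map_neg]
  exact le_of_dominated fun x => by simp [abs_of_nonneg (hf x)]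

theorem add {f₁ f₂ : C(K, ℝ)} (h₁ : ∀ x, 0 ≤ f₁ x) (h₂ : ∀ x, 0 ≤ f₂ x) :
    functionalVariation φ (f₁ + f₂) = functionalVariation φ f₁ + functionalVariation φ f₂ := by
  apply le_antisymm
  · refine le_of_forall (fun x => add_nonneg (h₁ x) (h₂ x)) fun g hg => ?_
    -- Riesz decomposition: clipping `g` to `[-f₁, f₁]` leaves a remainder dominated by `f₂`.
    have hsplit : g = (-f₁ ⊔ (g ⊓ f₁)) + (g - (-f₁ ⊔ (g ⊓ f₁))) := by abel
    rw [hsplit, map_add]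
    refine add_le_add (le_of_dominated fun x => ?_) (le_of_dominated fun x => ?_)
    · have := h₁ x
      simp only [ContinuousMap.sup_apply, ContinuousMap.inf_apply, ContinuousMap.neg_apply]
      grind
    · have := h₁ x
      have := h₂ x
      have := hg x
      simp only [ContinuousMap.sup_apply, ContinuousMap.inf_apply, ContinuousMap.neg_apply,
        ContinuousMap.sub_apply, ContinuousMap.add_apply] at *
      grind
  · have key : ∀ g₁ : C(K, ℝ), (∀ x, |g₁ x| ≤ f₁ x) →
        functionalVariation φ f₂ ≤ functionalVariation φ (f₁ + f₂) - φ g₁ := by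
      intro g₁ hg₁
      refine le_of_forall h₂ fun g₂ hg₂ => ?_
      rw [le_sub_iff_add_le', ← map_add]
      exact le_of_dominated fun x => (abs_add_le _ _).trans (add_le_add (hg₁ x) (hg₂ x))
    rw [← le_sub_iff_add_le]
    exact le_of_forall h₁ fun g hg => by linarith [key g hg]

theorem smul_le {f : C(K, ℝ)} (hf : ∀ x, 0 ≤ f x) {c : ℝ} (hc : 0 < c) :
    functionalVariation φ (c • f) ≤ c * functionalVariation φ f := by
  refine le_of_forall (fun x => mul_nonneg hc.le (hf x)) fun g hg => ?_
  have : φ (c⁻¹ • g) ≤ functionalVariation φ f := le_of_dominated fun x => by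
    have := hg x
    simp only [ContinuousMap.smul_apply, smul_eq_mul, abs_mul, abs_of_pos (inv_pos.2 hc)] at *
    rwa [inv_mul_le_iff₀ hc]
  rwa [map_smul, smul_eq_mul, inv_mul_le_iff₀ hc] at this

theorem smul {f : C(K, ℝ)} (hf : ∀ x, 0 ≤ f x) {c : ℝ} (hc : 0 ≤ c) :
    functionalVariation φ (c • f) = c * functionalVariation φ f := by
  rcases hc.eq_or_lt with rfl | hc
  · refine le_antisymm (le_of_forall (by simp) fun g hg => ?_) ?_
    · have : g = 0 := by
        ext x
        simpa using hg x
      simp [this]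
    · simpa using nonneg (φ := φ) (f := (0 : ℝ) • f) (by simp)
  · refine le_antisymm (smul_le hf hc) ?_
    have := smul_le (φ := φ) (f := c • f) (fun x => mul_nonneg hc.le (hf x)) (inv_pos.2 hc)
    rwa [inv_smul_smul₀ hc.ne', le_inv_mul_iff₀ hc] at this

end functionalVariation

variable [CompactSpace K]

/-- A continuous functional on `C(K, ℝ)` is dominated, on nonnegative functions, by the integral
with respect to a finite measure. -/
theorem exists_measure_abs_le_integral [T2Space K] [MeasurableSpace K] [BorelSpace K]
    (φ : C(K, ℝ) →L[ℝ] ℝ) :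
    ∃ μ : Measure K, IsFiniteMeasure μ ∧
      ∀ f : C(K, ℝ), (∀ x, 0 ≤ f x) → |φ f| ≤ ∫ x, f x ∂μ := by
  let T : C_c(K, ℝ≥0) → C(K, ℝ) := fun F => ⟨fun x => (F x : ℝ), by fun_prop⟩
  have hT : ∀ F x, 0 ≤ T F x := fun F x => (F x).2
  -- The variation is additive and positively homogeneous on nonnegative functions, so
  -- Riesz–Markov–Kakutani applies to it.
  let Λ : C_c(K, ℝ≥0) →ₗ[ℝ≥0] ℝ≥0 :=
    { toFun := fun F => ⟨functionalVariation φ (T F), functionalVariation.nonneg (hT F)⟩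
      map_add' := fun F G => NNReal.eq (functionalVariation.add (hT F) (hT G))
      map_smul' := fun c F => NNReal.eq (functionalVariation.smul (hT F) c.2) }
  refine ⟨NNRealRMK.rieszMeasure Λ, inferInstance, fun f hf => ?_⟩
  let F : C_c(K, ℝ≥0) :=
    { toFun := fun x => ⟨f x, hf x⟩
      continuous_toFun := f.continuous.subtype_mk _
      hasCompactSupport' := HasCompactSupport.of_compactSpace _ }
  have h := NNRealRMK.integral_rieszMeasure Λ F
  exact (functionalVariation.abs_le hf).trans_eq h.symm

/-- A uniformly bounded family of nonnegative continuous functions on a compact space that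
converges pointwise to zero along the cofinite filter converges weakly to zero. -/
theorem tendsto_cofinite_toWeakSpace_zero [T2Space K] {ι : Type*} {u : ι → C(K, ℝ)}
    (h0 : ∀ i x, 0 ≤ u i x) (h1 : ∀ i x, u i x ≤ 1)
    (hu : ∀ x, Tendsto (fun i => u i x) cofinite (𝓝 0)) :
    Tendsto (fun i => toWeakSpace ℝ C(K, ℝ) (u i)) cofinite (𝓝 0) := by
  borelize K
  have hB : Function.Injective (topDualPairing ℝ C(K, ℝ)).flip := by
    intro f g hfg
    ext x
    exact DFunLike.congr_fun hfg (ContinuousMap.evalCLM ℝ x)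
  refine (WeakBilin.tendsto_iff_forall_eval_tendsto _ hB).2 fun φ => ?_
  obtain ⟨μ, _, hμ⟩ := exists_measure_abs_le_integral φ
  change Tendsto (fun i => φ (u i)) cofinite (𝓝 (φ 0))
  rw [map_zero, Metric.tendsto_nhds]
  intro ε hε
  rw [eventually_cofinite]
  by_contra hinf
  -- Dominated convergence is applied to a sequence, here an injective one of exceptional indices.
  let s := Set.Infinite.natEmbedding _ hinf
  have hs : Tendsto (fun n => (s n : ι)) atTop cofinite := by
    rw [← Nat.cofinite_eq_atTop]
    exact (Subtype.val_injective.comp s.injective).tendsto_cofinite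
  have hlim : Tendsto (fun n => ∫ x, u (s n) x ∂μ) atTop (𝓝 (∫ _, (0 : ℝ) ∂μ)) := by
    refine tendsto_integral_of_dominated_convergence (fun _ => 1)
      (fun n => (u (s n)).continuous.aestronglyMeasurable) (integrable_const _)
      (fun n => Eventually.of_forall fun x => ?_) (Eventually.of_forall fun x => (hu x).comp hs)
    rw [Real.norm_of_nonneg (h0 _ _)]
    exact h1 _ _
  rw [integral_zero] at hlim
  obtain ⟨n, hn⟩ := (hlim.eventually (gt_mem_nhds hε)).exists
  have := (s n).2
  simp only [dist_zero_right, Real.norm_eq_abs, mem_ofPred_eq, not_lt] at this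
  linarith [hμ (u (s n)) (h0 _)]

end WeakConvergence

/-! ### Adequate families as compact subsets of the cube -/

section Cube

variable {X : Type*}

/-- The indicator function of a coordinate, as a continuous function on a family of sets. -/
noncomputable def coordinateFunction (𝓕 : Set (Set X)) (x : X) : C(familyInCube 𝓕, ℝ) where
  toFun k := if k.1 x then 1 else 0
  continuous_toFun := (continuous_of_discreteTopology (f := fun b : Bool => if b then (1 : ℝ) else 0)
    ).comp ((continuous_apply x).comp continuous_subtype_val)

theorem coordinateFunction_apply (𝓕 : Set (Set X)) (x : X) (k : familyInCube 𝓕) :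
    coordinateFunction 𝓕 x k = if k.1 x then 1 else 0 :=
  rfl

open Classical in
/-- A member of a family of sets, as a point of the associated subspace of the cube. -/
noncomputable def familyInCube.ofMem {𝓕 : Set (Set X)} {B : Set X} (hB : B ∈ 𝓕) :
    familyInCube 𝓕 :=
  ⟨fun x => decide (x ∈ B), by simpa [familyInCube] using hB⟩

open Classical in
theorem coordinateFunction_ofMem {𝓕 : Set (Set X)} {B : Set X} (hB : B ∈ 𝓕) (x : X) :
    coordinateFunction 𝓕 x (familyInCube.ofMem hB) = if x ∈ B then 1 else 0 := by
  simp [coordinateFunction, familyInCube.ofMem]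

theorem mem_restrictFamily_iff {𝒜 : Set (Set X)} (h𝒜 : IsAdequateFamily 𝒜) {Z B : Set X} :
    B ∈ restrictFamily 𝒜 Z ↔ B ∈ 𝒜 ∧ B ⊆ Z := by
  constructor
  · rintro ⟨A, hA, rfl⟩
    exact ⟨h𝒜.hereditary A hA _ inter_subset_left, inter_subset_right⟩
  · rintro ⟨hB, hBZ⟩
    exact ⟨B, hB, (inter_eq_left.2 hBZ).symm⟩

/-- Adequacy makes membership a test on finite sets: each finite `F ∉ 𝒜` excludes an open cylinder,
and each point off `Z` imposes a closed condition. -/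
theorem isClosed_familyInCube_restrictFamily {𝒜 : Set (Set X)} (h𝒜 : IsAdequateFamily 𝒜)
    (Z : Set X) : IsClosed (familyInCube (restrictFamily 𝒜 Z)) := by
  have : familyInCube (restrictFamily 𝒜 Z) =
      (⋂ F ∈ {F : Set X | F.Finite ∧ F ∉ 𝒜}, {k : X → Bool | ∀ x ∈ F, k x = true}ᶜ) ∩
        ⋂ x ∈ Zᶜ, {k : X → Bool | k x = false} := by
    ext k
    simp only [familyInCube, mem_restrictFamily_iff h𝒜, mem_inter_iff, mem_iInter, mem_ofPred_eq,
      mem_compl_iff]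
    refine and_congr ⟨fun hk F hF hkF => hF.2 (h𝒜.hereditary _ hk F hkF), fun hk => ?_⟩ ?_
    · refine h𝒜.finite_character _ fun F hFk hF => ?_
      by_contra hFA
      exact hk F ⟨hF, hFA⟩ hFk
    · refine forall_congr' fun x => ?_
      simp only [mem_ofPred_eq]
      rw [← not_imp_not, Bool.not_eq_true]
  rw [this]
  refine (isClosed_biInter fun F hF => ?_).inter (isClosed_biInter fun x _ => ?_)
  · rw [isClosed_compl_iff]
    have : {k : X → Bool | ∀ x ∈ F, k x = true} = F.pi fun _ => {true} := by
      ext k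
      simp [Set.mem_pi]
    rw [this]
    exact isOpen_set_pi hF.1 fun _ _ => isOpen_discrete _
  · exact IsClosed.preimage (f := fun k : X → Bool => k x) (continuous_apply x)
      (isClosed_discrete {false})

theorem compactSpace_familyInCube_restrictFamily {𝒜 : Set (Set X)} (h𝒜 : IsAdequateFamily 𝒜)
    (Z : Set X) : CompactSpace (familyInCube (restrictFamily 𝒜 Z)) :=
  isCompact_iff_compactSpace.1 (isClosed_familyInCube_restrictFamily h𝒜 Z).isCompact

/-- If the coordinates of a set `A`, all of whose subsets belong to the family, are uniformly
within `1 / 4` of a pointwise compact set of continuous functions, then `A` is finite. -/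
theorem finite_of_coordinateFunction_near_compact {𝓕 : Set (Set X)} {A : Set X}
    (hA : ∀ B ⊆ A, B ∈ 𝓕) {T : Set (familyInCube 𝓕 → ℝ)} (hT : IsCompact T)
    (hcont : ∀ w ∈ T, Continuous w)
    (hnear : ∀ x ∈ A, ∃ w ∈ T, ∀ k, |coordinateFunction 𝓕 x k - w k| ≤ 1 / 4) : A.Finite := by
  classical
  by_contra hinf
  have : Infinite A := Set.infinite_coe_iff.2 hinf
  choose! w hw hxw using hnear
  let U : Ultrafilter A := hyperfilter A
  obtain ⟨v, hvT, hv⟩ := hT.ultrafilter_le_nhds (U.map fun x => w x)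
    (by
      rw [le_principal_iff]
      exact (Eventually.of_forall fun x => hw x x.2 : ∀ᶠ x : A in U, w x ∈ T))
  have hlim : ∀ k, Tendsto (fun x : A => w x k) U (𝓝 (v k)) := fun k =>
    ((continuous_apply k).tendsto v).comp (show Tendsto (fun x : A => w x) U (𝓝 v) from hv)
  have hfin : ∀ F : Finset A, v (familyInCube.ofMem (hA (Subtype.val '' (F : Set A))
      (by rintro _ ⟨x, -, rfl⟩; exact x.2))) ≤ 1 / 4 := by
    intro F
    refine le_of_tendsto (hlim _) ?_
    -- `U` is nonprincipal, so `U`-almost every coordinate vanishes at the finite set `F`.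
    have hF : ∀ᶠ x in U, x ∉ F :=
      hyperfilter_le_cofinite F.finite_toSet.compl_mem_cofinite
    filter_upwards [hF] with x hx
    have := hxw x x.2 (familyInCube.ofMem (hA (Subtype.val '' (F : Set A))
      (by rintro _ ⟨x, -, rfl⟩; exact x.2)))
    rw [coordinateFunction_ofMem, if_neg (by simpa using hx)] at this
    linarith [(abs_le.1 this).1]
  have hfull : 3 / 4 ≤ v (familyInCube.ofMem (hA A subset_rfl)) := by
    refine ge_of_tendsto (hlim _) (Eventually.of_forall fun x => ?_)
    have := hxw x x.2 (familyInCube.ofMem (hA A subset_rfl))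
    rw [coordinateFunction_ofMem, if_pos x.2] at this
    linarith [(abs_le.1 this).2]
  -- Finite subsets of `A` converge to `A` in the cube, so continuity of `v` contradicts the bounds
  -- `1 / 4` and `3 / 4`.
  have hconv : Tendsto (fun F : Finset A => familyInCube.ofMem (hA (Subtype.val '' (F : Set A))
      (by rintro _ ⟨x, -, rfl⟩; exact x.2))) atTop (𝓝 (familyInCube.ofMem (hA A subset_rfl))) := by
    rw [tendsto_subtype_rng, tendsto_pi_nhds]
    intro x
    by_cases hx : x ∈ A
    · refine tendsto_const_nhds.congr' ?_
      filter_upwards [eventually_ge_atTop {⟨x, hx⟩}] with F hF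
      have : (⟨x, hx⟩ : A) ∈ F := hF (by simp)
      simp [familyInCube.ofMem, hx, this]
    · simp [familyInCube.ofMem, hx]
  have := le_of_tendsto (((hcont v hvT).tendsto _).comp hconv) (Eventually.of_forall hfin)
  linarith

end Cube

/-- In a weakly compactly generated space of continuous functions, countably many pointwise compact
sets of continuous functions come uniformly arbitrarily close to every continuous function. -/
theorem IsWeaklyCompactlyGenerated.exists_pointwise_compact {K : Type*} [TopologicalSpace K]
    [CompactSpace K] (h : IsWeaklyCompactlyGenerated C(K, ℝ)) :
    ∃ T : ℕ → ℕ → Set (K → ℝ), (∀ m n, IsCompact (T m n)) ∧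
      (∀ m n, ∀ w ∈ T m n, Continuous w) ∧
      ∀ (f : C(K, ℝ)) (ε : ℝ), 0 < ε → ∃ m n, ∃ w ∈ T m n, ∀ k, |f k - w k| ≤ ε := by
  obtain ⟨W, hW, hdense⟩ := h
  -- Evaluations are continuous functionals, so weak compactness passes to pointwise compactness.
  let W' : Set (K → ℝ) := (fun f : C(K, ℝ) => (f : K → ℝ)) '' W
  have hW' : IsCompact W' := by
    have hcont : Continuous fun f : WeakSpace ℝ C(K, ℝ) =>
        (((toWeakSpace ℝ C(K, ℝ)).symm f : C(K, ℝ)) : K → ℝ) := by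
      refine continuous_pi fun k => ?_
      exact WeakBilin.eval_continuous (topDualPairing ℝ C(K, ℝ)).flip (ContinuousMap.evalCLM ℝ k)
    have := hW.image hcont
    rw [image_image] at this
    simpa using this
  refine ⟨fun m n => (fun p : (Fin m → ℝ) × (Fin m → K → ℝ) => ∑ i, p.1 i • p.2 i) ''
    ((univ.pi fun _ => Icc (-(n : ℝ)) n) ×ˢ (univ.pi fun _ => W')), fun m n => ?_, ?_, ?_⟩
  · exact ((isCompact_univ_pi fun _ => isCompact_Icc).prod
      (isCompact_univ_pi fun _ => hW')).image (by fun_prop)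
  · rintro m n _ ⟨⟨c, g⟩, ⟨-, hg⟩, rfl⟩
    have : ∀ i, Continuous (g i) := fun i => by
      obtain ⟨f, -, hf⟩ := hg i trivial
      change (f : K → ℝ) = g i at hf
      rw [← hf]
      exact f.continuous
    change Continuous (∑ i, c i • g i)
    rw [Finset.sum_fn]
    exact continuous_finsetSum _ fun i _ => (this i).const_smul (c i)
  · intro f ε hε
    obtain ⟨s, hs, hfs⟩ := Metric.mem_closure_iff.1 (hdense f) ε hε
    obtain ⟨m, c, g, rfl⟩ := Submodule.mem_span_set'.1 hs
    obtain ⟨n, hn⟩ := exists_nat_ge (∑ i, |c i|)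
    refine ⟨m, n, _, ⟨(c, fun i => (g i : C(K, ℝ))), ⟨fun i _ => ?_, fun i _ => ?_⟩, rfl⟩,
      fun k => ?_⟩
    · exact abs_le.1 ((Finset.single_le_sum (fun j _ => abs_nonneg (c j))
        (Finset.mem_univ i)).trans hn)
    · exact ⟨_, (g i).2, rfl⟩
    · have := (ContinuousMap.dist_apply_le_dist k).trans hfs.le
      rw [Real.dist_eq] at this
      simpa [ContinuousMap.sum_apply, Finset.sum_apply] using this

/-! ### Weakly compact generating sets -/

section WeaklyCompactlyGenerated

variable {X : Type*}

theorem isWeaklyCompactlyGenerated_of_tendsto {E ι : Type*} [NormedAddCommGroup E]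
    [NormedSpace ℝ E] {u : ι → E}
    (hu : Tendsto (fun i => toWeakSpace ℝ E (u i)) cofinite (𝓝 0))
    (hdense : Dense (Submodule.span ℝ (range u) : Set E)) : IsWeaklyCompactlyGenerated E := by
  refine ⟨insert 0 (range u), ?_, hdense.mono (Submodule.span_mono (subset_insert _ _))⟩
  rw [image_insert_eq, map_zero, ← range_comp]
  exact hu.isCompact_insert_range_of_cofinite

/-- Coordinates in `Z` separate points, as members of `𝓕` have no points off `Z`. Coordinate
functions are idempotent, so the products over finite sets are closed under multiplication, and
Stone–Weierstrass applies. -/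
theorem dense_span_range_prod_coordinateFunction {𝓕 : Set (Set X)} {Z : Set X}
    [CompactSpace (familyInCube 𝓕)] (h𝓕 : ∀ A ∈ 𝓕, A ⊆ Z) :
    Dense (Submodule.span ℝ (range fun F : Finset Z => ∏ x ∈ F, coordinateFunction 𝓕 x) :
      Set C(familyInCube 𝓕, ℝ)) := by
  classical
  let S : Set C(familyInCube 𝓕, ℝ) := range fun x : Z => coordinateFunction 𝓕 x
  have hsep : (Algebra.adjoin ℝ S).SeparatesPoints := by
    intro k l hkl
    by_contra! hall
    apply hkl
    refine Subtype.ext (funext fun x => ?_)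
    by_cases hx : x ∈ Z
    · have := hall _ ⟨_, Algebra.subset_adjoin ⟨⟨x, hx⟩, rfl⟩, rfl⟩
      simp only [coordinateFunction_apply] at this
      cases hk : k.1 x <;> cases hl : l.1 x <;> simp_all
    · have hk : k.1 x = false := Bool.eq_false_iff.2 fun h => hx (h𝓕 _ k.2 h)
      have hl : l.1 x = false := Bool.eq_false_iff.2 fun h => hx (h𝓕 _ l.2 h)
      rw [hk, hl]
  have htop := ContinuousMap.subalgebra_topologicalClosure_eq_top_of_separatesPoints _ hsep
  have hidem : ∀ x : X, coordinateFunction 𝓕 x * coordinateFunction 𝓕 x =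
      coordinateFunction 𝓕 x := by
    intro x
    ext k
    simp [coordinateFunction_apply]
  have hle : (Submonoid.closure S : Set C(familyInCube 𝓕, ℝ)) ⊆
      range fun F : Finset Z => ∏ x ∈ F, coordinateFunction 𝓕 x := by
    intro f hf
    induction hf using Submonoid.closure_induction with
    | mem f hf =>
      obtain ⟨x, rfl⟩ := hf
      exact ⟨{x}, by simp⟩
    | one => exact ⟨∅, by simp⟩
    | mul f g _ _ hf hg =>
      obtain ⟨F, rfl⟩ := hf
      obtain ⟨G, rfl⟩ := hg
      refine ⟨F ∪ G, ?_⟩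
      ext k
      simp only [ContinuousMap.prod_apply, ContinuousMap.mul_apply, coordinateFunction_apply,
        Finset.prod_ite_zero, Finset.prod_const_one, Finset.mem_union]
      grind
  have hdense : Dense (Algebra.adjoin ℝ S : Set C(familyInCube 𝓕, ℝ)) := by
    rw [dense_iff_closure_eq, ← Subalgebra.topologicalClosure_coe, htop, Algebra.coe_top]
  refine hdense.mono ?_
  intro f hf
  rw [SetLike.mem_coe, ← Subalgebra.mem_toSubmodule, Algebra.adjoin_eq_span] at hf
  exact Submodule.span_mono hle hf

/-- The space of continuous functions on a family of subsets of `Z` is weakly compactly generated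
if `Z` is the increasing union of sets that meet each member of the family in a finite set. -/
theorem isWeaklyCompactlyGenerated_of_finite_inter {𝓕 : Set (Set X)} {Z : Set X}
    [CompactSpace (familyInCube 𝓕)] (h𝓕 : ∀ A ∈ 𝓕, A ⊆ Z) (r : X → ℕ)
    (hr : ∀ A ∈ 𝓕, ∀ n, {x ∈ A | r x ≤ n}.Finite) :
    IsWeaklyCompactlyGenerated C(familyInCube 𝓕, ℝ) := by
  classical
  let e : Finset Z → C(familyInCube 𝓕, ℝ) := fun F => ∏ x ∈ F, coordinateFunction 𝓕 x
  -- With this weight, `c F * e F ≥ ε` at a member `A` forces `F` into a set `{x ∈ A | r x ≤ n}`,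
  -- which is finite and so has finitely many subsets `F`.
  let c : Finset Z → ℝ := fun F => 1 / ((F.sup fun x => r x : ℕ) + 1)
  have hc : ∀ F, 0 < c F := fun F => by positivity
  have hc1 : ∀ F, c F ≤ 1 := fun F => by
    refine div_le_one_of_le₀ ?_ (by positivity)
    simp
  have he : ∀ F k, e F k = if ∀ x ∈ F, k.1 (x : X) = true then 1 else 0 := by
    intro F k
    simp [e, ContinuousMap.prod_apply, coordinateFunction_apply, Finset.prod_ite_zero]
  have he0 : ∀ F k, 0 ≤ e F k := fun F k => by rw [he]; split_ifs <;> simp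
  have he1 : ∀ F k, e F k ≤ 1 := fun F k => by rw [he]; split_ifs <;> simp
  refine isWeaklyCompactlyGenerated_of_tendsto (u := fun F => c F • e F)
    (tendsto_cofinite_toWeakSpace_zero (fun F k => mul_nonneg (hc F).le (he0 F k))
      (fun F k => mul_le_one₀ (hc1 F) (he0 F k) (he1 F k)) fun k => ?_)
    ((dense_span_range_prod_coordinateFunction h𝓕).mono (Submodule.span_le.2 ?_))
  · rw [Metric.tendsto_nhds]
    intro ε hε
    obtain ⟨n, hn⟩ := exists_nat_one_div_lt hε
    rw [eventually_cofinite]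
    have hfin : ((Subtype.val : Z → X) ⁻¹' {x ∈ {t | k.1 t = true} | r x ≤ n}).Finite :=
      (hr _ k.2 n).preimage Subtype.val_injective.injOn
    refine (hfin.toFinset.powerset.finite_toSet).subset fun F hF => ?_
    have hF' : ε ≤ c F * e F k := by
      simpa [abs_of_nonneg (mul_nonneg (hc F).le (he0 F k)), abs_of_pos (hc F),
        abs_of_nonneg (he0 F k)] using hF
    have hk : ∀ x ∈ F, k.1 (x : X) = true := by
      by_contra hk
      rw [he, if_neg hk, mul_zero] at hF'
      exact absurd hF' hε.not_ge
    rw [he, if_pos hk, mul_one] at hF'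
    have hsup : (F.sup fun x => r x : ℕ) ≤ n := by
      by_contra! hlt
      have : c F ≤ 1 / ((n : ℝ) + 1) := by
        have : (n : ℝ) ≤ (F.sup fun x => r x : ℕ) := by exact_mod_cast hlt.le
        exact one_div_le_one_div_of_le (by positivity) (by linarith)
      linarith
    simp only [Finset.coe_powerset, mem_preimage, mem_powerset_iff]
    intro x hx
    simpa using ⟨hk x hx, (Finset.le_sup (f := fun x : Z => r x) hx).trans hsup⟩
  · rintro _ ⟨F, rfl⟩
    have : e F = (c F)⁻¹ • c F • e F := (inv_smul_smul₀ (hc F).ne' _).symm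
    change e F ∈ _
    rw [this]
    exact Submodule.smul_mem _ _ (Submodule.subset_span ⟨F, rfl⟩)

end WeaklyCompactlyGenerated

/-! ### Eberlein compactness and σ-compact covers -/

theorem IsCoanalyticSpace.metrizableSpace {X : Type*} [TopologicalSpace X]
    (hX : IsCoanalyticSpace X) : TopologicalSpace.MetrizableSpace X := by
  obtain ⟨P, _, f, _, hf, -⟩ := hX
  exact hf.metrizableSpace

theorem mainTheorem4 {X : Type*} [TopologicalSpace X] (hX : IsCoanalyticSpace X)
    (𝒜 : Set (Set X)) (h𝒜 : IsCofinalAdequateFamily 𝒜) (Z : Set X) :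
    IsEberleinCompact (familyInCube (restrictFamily 𝒜 Z)) ↔
      ∃ S : Set X, IsSigmaCompact S ∧ Z ⊆ S := by
  have := hX.metrizableSpace
  have hmem {B : Set X} := mem_restrictFamily_iff h𝒜.toIsAdequateFamily (Z := Z) (B := B)
  constructor
  · rintro ⟨_, -, hwcg⟩
    obtain ⟨T, hT, hcont, hdense⟩ := hwcg.exists_pointwise_compact
    let S : ℕ → ℕ → Set X := fun m n => {x ∈ Z | ∃ w ∈ T m n,
      ∀ k, |coordinateFunction (restrictFamily 𝒜 Z) x k - w k| ≤ 1 / 4}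
    have hS : ∀ m n, IsCompact (closure (S m n)) := by
      refine fun m n => isCompact_closure_of_forall_finite fun B hB hBc hBd => ?_
      by_contra hinf
      obtain ⟨A, hAB, hAinf, hA⟩ := h𝒜.cofinal B hinf hBc hBd
      refine hAinf (finite_of_coordinateFunction_near_compact (fun C hC => ?_) (hT m n)
        (hcont m n) fun x hx => (hB (hAB hx)).2)
      exact hmem.2 ⟨h𝒜.hereditary A hA C hC, fun x hx => (hB (hAB (hC hx))).1⟩
    refine ⟨⋃ m, ⋃ n, closure (S m n), isSigmaCompact_iUnion _ fun m =>
      isSigmaCompact_iUnion_of_isCompact _ (hS m), fun x hx => ?_⟩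
    obtain ⟨m, n, hw⟩ := hdense (coordinateFunction _ x) (1 / 4) (by norm_num)
    exact mem_iUnion₂.2 ⟨m, n, subset_closure ⟨hx, hw⟩⟩
  · rintro ⟨S, ⟨C, hC, rfl⟩, hZ⟩
    have hcpt := compactSpace_familyInCube_restrictFamily h𝒜.toIsAdequateFamily Z
    -- The rank `r x` is the index of a compact piece containing `x`; its value off `Z` is
    -- immaterial.
    have hex : ∀ x : X, ∃ n, x ∈ Z → x ∈ C n := fun x => by
      by_cases hx : x ∈ Z
      · obtain ⟨n, hn⟩ := mem_iUnion.1 (hZ hx)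
        exact ⟨n, fun _ => hn⟩
      · exact ⟨0, fun h => absurd h hx⟩
    choose r hr using hex
    refine ⟨hcpt, inferInstance, isWeaklyCompactlyGenerated_of_finite_inter (Z := Z)
      (fun A hA => (hmem.1 hA).2) r fun A hA n => ?_⟩
    obtain ⟨hA, hAZ⟩ := hmem.1 hA
    have hclosed : ∀ B ⊆ A, IsClosed B := fun B hB => h𝒜.closed B (h𝒜.hereditary A hA B hB)
    have hcompact : IsCompact (A ∩ ⋃ i ∈ Iic n, C i) :=
      ((finite_Iic n).isCompact_biUnion fun i _ => hC i).inter_left (hclosed A subset_rfl)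
    refine (hcompact.finite ((isDiscrete_of_forall_subset_isClosed hclosed).mono
      inter_subset_left)).subset ?_
    rintro x ⟨hxA, hxn⟩
    exact ⟨hxA, mem_biUnion (mem_Iic.2 hxn) (hr x (hAZ hxA))⟩
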